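/- Theorem 1.5. Let $(T,\mathcal F,\mu)$ be a measure space with $0<\mu(T)<+\infty$ which is non-atomic, i.e. every $A\in\mathcal F$ with $\mu(A)>0$ contains some $B\in\mathcal F$ with $0<\mu(B)<\mu(A)$. Let $E$ be a real Banach space, let $p\in[1,+\infty)$, and let $f,g:E\to\mathbb R$ be two functions, with $f$ lower semicontinuous and $g$ continuous, such that $$\sup_E f<+\infty,\qquad \inf_E g=-\infty,\qquad \sup_E g=+\infty,$$ $$\max\left\{\sup_{x\in E}\frac{|f(x)|}{1+\|x\|^p},\ \sup_{x\in E}\frac{|g(x)|}{1+\|x\|^p}\right\}<+\infty .$$ Assume that $f$ has at most one global minimum (that is, there is at most one point $x\in E$ with $f(x)=\min_E f$), and that no zero of $g$ is a global minimum of $f$. Then for every $u\in L^p(T,E)$ the functions $f\circ u$ and $g\circ u$ are $\mu$-integrable, so that $$J(u)=\int_T f(u(t))\,d\mu+\left(\int_T g(u(t))\,d\mu\right)^2$$ is a well-defined real number. Moreover, let $X\subseteq L^p(T,E)$ contain (the classes of) all constant functions and be decomposable, i.e. for all $u,v\in X$ and $A\in\mathcal F$ the function $\chi_A u+(1-\chi_A)v$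 belongs to $X$. Then the restriction of $J$ to $X$ has no global minimum, i.e. there is no $u\in X$ with $J(u)\le J(v)$ for all $v\in X$. -/

import Mathlib

open MeasureTheory

/-- A measure is non-atomic if it has no atoms in the measure-theoretic sense: every measurable
set of positive measure has a measurable subset of strictly smaller positive measure.
This is in general stronger than all singletons being null. -/
def IsNonatomicMeasure {T : Type*} [MeasurableSpace T] (μ : Measure T) : Prop :=
  ∀ A : Set T, MeasurableSet A → 0 < μ A →
    ∃ B : Set T, MeasurableSet B ∧ B ⊆ A ∧ 0 < μ B ∧ μ B < μ A

/-- A set `D` of (classes of) `L^p` functions is decomposable if for all `u, v ∈ D` and every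
measurable set `A` the class of `χ_A u + (1 - χ_A) v` belongs to `D`. -/
def IsDecomposable {T E : Type*} [MeasurableSpace T] [NormedAddCommGroup E] [NormedSpace ℝ E]
    {p : ENNReal} {μ : Measure T} (D : Set (Lp E p μ)) : Prop :=
  ∀ u ∈ D, ∀ v ∈ D, ∀ A : Set T, MeasurableSet A →
    ∃ w ∈ D, (w : T → E) =ᵐ[μ] fun t =>
      A.indicator (fun _ => (1 : ℝ)) t • u t + (1 - A.indicator (fun _ => (1 : ℝ)) t) • v t

/-- The functional `J(u) = ∫ f(u(t)) dμ + (∫ g(u(t)) dμ)²` on `L^p(T, E)`. -/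
noncomputable def integralFunctional {T E : Type*} [MeasurableSpace T] [NormedAddCommGroup E]
    {p : ENNReal} {μ : Measure T} (f g : E → ℝ) (u : Lp E p μ) : ℝ :=
  (∫ t, f (u t) ∂μ) + (∫ t, g (u t) ∂μ) ^ 2

/-! Let `u` minimise `J` on `X` and put `c = ∫ g ∘ u`. Replacing `u` by a constant `x` on a small
set `A` changes `J` by `∫_A (φ x - φ ∘ u) + (∫_A (g x - g ∘ u))²`, where `φ = f + 2 c g`. The square
is of smaller order than the linear term, and non-atomicity provides small sets inside any set of
positive measure, so almost every `u t` is a global minimum of `φ`. In particular `φ` is bounded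
below; as `f` is bounded above and `g` is unbounded on both sides, `c = 0`. Hence almost every `u t`
is the unique global minimum of `f`, so `u` is essentially constant, and `∫ g ∘ u = c = 0` makes its
value a zero of `g`. -/

section NonatomicMeasure

open Filter Set Topology

variable {T : Type*} [MeasurableSpace T] {μ : Measure T}

namespace IsNonatomicMeasure

theorem exists_subset_measure_le_half (hμ : IsNonatomicMeasure μ) {A : Set T}
    (hA : MeasurableSet A) (hA₀ : 0 < μ A) :
    ∃ B ⊆ A, MeasurableSet B ∧ 0 < μ B ∧ μ B ≤ μ A / 2 := by
  obtain ⟨B, hB, hBA, hB₀, hlt⟩ := hμ A hA hA₀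
  have hsplit : μ B + μ (A \ B) = μ A := by
    simpa only [inter_eq_self_of_subset_right hBA] using measure_inter_add_sdiff A hB
  rcases le_or_gt (μ B) (μ A / 2) with hle | hgt
  · exact ⟨B, hBA, hB, hB₀, hle⟩
  · refine ⟨A \ B, sdiff_subset, hA.diff hB, pos_iff_ne_zero.2 fun hdiff => ?_, ?_⟩
    · exact hlt.ne (by rw [← hsplit, hdiff, add_zero])
    · by_contra! hgt'
      exact (ENNReal.add_lt_add hgt hgt').ne (by rw [ENNReal.add_halves, hsplit])

theorem exists_subset_measure_lt (hμ : IsNonatomicMeasure μ) {S : Set T} (hS : MeasurableSet S)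
    (hS₀ : 0 < μ S) {δ : ENNReal} (hδ : 0 < δ) :
    ∃ A ⊆ S, MeasurableSet A ∧ 0 < μ A ∧ μ A < δ := by
  obtain ⟨F, hF, hFS, hF₀, hF_lt⟩ := hμ S hS hS₀
  -- Halving starts from `F`, which has finite measure even when `S` does not.
  have halving : ∀ n : ℕ, ∃ A ⊆ S, MeasurableSet A ∧ 0 < μ A ∧ μ A ≤ μ F * 2⁻¹ ^ n := by
    intro n
    induction n with
    | zero => exact ⟨F, hFS, hF, hF₀, by rw [pow_zero, mul_one]⟩
    | succ n ih =>
      obtain ⟨A, hAS, hA, hA₀, hle⟩ := ih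
      obtain ⟨B, hBA, hB, hB₀, hBle⟩ := hμ.exists_subset_measure_le_half hA hA₀
      refine ⟨B, hBA.trans hAS, hB, hB₀, hBle.trans ?_⟩
      rw [pow_succ, ← mul_assoc, ← div_eq_mul_inv]
      gcongr
  obtain ⟨n, hn⟩ := ENNReal.exists_inv_two_pow_lt (ENNReal.div_pos hδ.ne' hF_lt.ne_top).ne'
  obtain ⟨A, hAS, hA, hA₀, hle⟩ := halving n
  exact ⟨A, hAS, hA, hA₀, hle.trans_lt (mul_comm (μ F) _ ▸ ENNReal.mul_lt_of_lt_div hn)⟩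

end IsNonatomicMeasure

theorem setIntegral_neg_of_forall_neg {h : T → ℝ} {A : Set T} (hA : MeasurableSet A)
    (hA₀ : 0 < μ A) (hh : IntegrableOn h A μ) (hneg : ∀ t ∈ A, h t < 0) :
    ∫ t in A, h t ∂μ < 0 := by
  have hsupp : Function.support (-h) ∩ A = A :=
    inter_eq_right.2 fun t ht => neg_ne_zero.2 (hneg t ht).ne
  have hpos : 0 < ∫ t in A, (-h) t ∂μ := by
    rwa [setIntegral_pos_iff_support_of_nonneg_ae _ hh.neg, hsupp]
    filter_upwards [ae_restrict_mem hA] with t ht using neg_nonneg.2 (hneg t ht).le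
  simpa only [Pi.neg_apply, integral_neg, neg_pos] using hpos

theorem ae_nonneg_of_forall_ae_nonneg_add_mul {h k : T → ℝ}
    (hhk : ∀ ε > 0, ∀ᵐ t ∂μ, 0 ≤ h t + ε * k t) : ∀ᵐ t ∂μ, 0 ≤ h t := by
  filter_upwards [ae_all_iff.2 fun n : ℕ => hhk (1 / ((n : ℝ) + 1)) Nat.one_div_pos_of_nat]
    with t ht
  have hlim : Tendsto (fun n : ℕ => h t + 1 / ((n : ℝ) + 1) * k t) atTop (𝓝 (h t)) := by
    simpa only [zero_mul, add_zero] using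
      (tendsto_one_div_add_atTop_nhds_zero_nat.mul_const (k t)).const_add (h t)
  exact ge_of_tendsto' hlim ht

theorem sq_integral_le_mul_integral_abs {k : T → ℝ} {ε : ℝ} (hε : ∫ t, |k t| ∂μ ≤ ε) :
    (∫ t, k t ∂μ) ^ 2 ≤ ε * ∫ t, |k t| ∂μ := by
  rw [← sq_abs, sq]
  have habs : |∫ t, k t ∂μ| ≤ ∫ t, |k t| ∂μ := abs_integral_le_integral_abs
  exact mul_le_mul (habs.trans hε) habs (abs_nonneg _) ((abs_nonneg _).trans (habs.trans hε))

theorem exists_pos_forall_setIntegral_abs_lt {k : T → ℝ} (hk : Integrable k μ) {ε : ℝ}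
    (hε : 0 < ε) : ∃ δ > 0, ∀ A, μ A < δ → ∫ t in A, |k t| ∂μ < ε := by
  have hlim : Tendsto (fun A : Set T => ∫ t in A, |k t| ∂μ) (comap μ (𝓝 0)) (𝓝 0) :=
    hk.abs.tendsto_setIntegral_nhds_zero tendsto_comap
  simpa using (ENNReal.nhds_zero_basis.comap μ).eventually_iff.1 (hlim.eventually_lt_const hε)

theorem IsNonatomicMeasure.ae_nonneg_of_forall_setIntegral_add_sq_nonneg
    (hμ : IsNonatomicMeasure μ) {h k : T → ℝ} (hh : Integrable h μ) (hk : Integrable k μ)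
    (hhk : ∀ A, MeasurableSet A → 0 ≤ (∫ t in A, h t ∂μ) + (∫ t in A, k t ∂μ) ^ 2) :
    ∀ᵐ t ∂μ, 0 ≤ h t := by
  refine ae_nonneg_of_forall_ae_nonneg_add_mul (k := fun t => |k t|) fun ε hε => ?_
  have hint : Integrable (fun t => h t + ε * |k t|) μ := hh.add (hk.abs.const_mul ε)
  by_contra hneg
  obtain ⟨S, hS_neg, hS, hS_ae⟩ :=
    (nullMeasurableSet_lt hint.aemeasurable
      (aemeasurable_const (b := (0 : ℝ)))).exists_measurable_subset_ae_eq
  have hS₀ : 0 < μ S := by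
    rw [measure_congr hS_ae, pos_iff_ne_zero]
    simpa only [ae_iff, not_le] using hneg
  obtain ⟨δ, hδ, hk_small⟩ := exists_pos_forall_setIntegral_abs_lt hk hε
  obtain ⟨A, hAS, hA, hA₀, hAδ⟩ := hμ.exists_subset_measure_lt hS hS₀ hδ
  refine (hhk A hA).not_gt ?_
  calc (∫ t in A, h t ∂μ) + (∫ t in A, k t ∂μ) ^ 2
      ≤ (∫ t in A, h t ∂μ) + ε * ∫ t in A, |k t| ∂μ := by
        gcongr
        exact sq_integral_le_mul_integral_abs (hk_small A hAδ).le
    _ = ∫ t in A, (h t + ε * |k t|) ∂μ := by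
        rw [← integral_const_mul,
          integral_add hh.integrableOn (hk.abs.const_mul ε).integrableOn]
    _ < 0 := setIntegral_neg_of_forall_neg hA hA₀ hint.integrableOn fun t ht => hS_neg (hAS ht)

end NonatomicMeasure

section Minimum

open Filter Set
open scoped Pointwise

theorem eventually_isMinOn_of_forall_eventually_le {T E : Type*} {l : Filter T}
    [CountableInterFilter l] {φ : E → ℝ} {u : T → E} (h : ∀ x, ∀ᶠ t in l, φ (u t) ≤ φ x) :
    ∀ᶠ t in l, IsMinOn φ univ (u t) := by
  -- Comparing with rational levels makes the exceptional set independent of `x`.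
  have hrat : ∀ᶠ t in l, ∀ q : ℚ, (∃ x, φ x < q) → φ (u t) < q := by
    refine eventually_countable_forall.2 fun q => ?_
    by_cases hq : ∃ x, φ x < q
    · obtain ⟨x, hx⟩ := hq
      filter_upwards [h x] with t ht _ using ht.trans_lt hx
    · exact Eventually.of_forall fun t hq' => absurd hq' hq
  filter_upwards [hrat] with t ht
  refine isMinOn_iff.2 fun x _ => le_of_forall_gt fun r hr => ?_
  obtain ⟨q, hxq, hqr⟩ := exists_rat_btwn hr
  exact (ht q ⟨x, hxq⟩).trans hqr

theorem eq_zero_of_bddBelow_range_add_mul {α : Type*} {f g : α → ℝ} {a : ℝ}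
    (hf : BddAbove (range f)) (hg_below : ¬ BddBelow (range g)) (hg_above : ¬ BddAbove (range g))
    (h : BddBelow (range fun x => f x + a * g x)) : a = 0 := by
  obtain ⟨M, hM⟩ := hf
  obtain ⟨m, hm⟩ := h
  have hag : BddBelow (a • range g) := by
    refine ⟨m - M, ?_⟩
    rintro _ ⟨_, ⟨x, rfl⟩, rfl⟩
    have hx : m ≤ f x + a * g x := hm (mem_range_self x)
    exact sub_le_iff_le_add'.2 (hx.trans (add_le_add_left (hM (mem_range_self x)) _))
  rcases lt_trichotomy a 0 with ha | ha | ha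
  · exact absurd ((bddBelow_smul_iff_of_neg ha).1 hag) hg_above
  · exact ha
  · exact absurd ((bddBelow_smul_iff_of_pos ha).1 hag) hg_below

end Minimum

section IntegralFunctional

open Set

variable {T E : Type*} [MeasurableSpace T] {μ : Measure T} [NormedAddCommGroup E]

theorem integrable_comp_of_bddAbove_div_one_add_rpow [IsFiniteMeasure μ] [MeasurableSpace E]
    [BorelSpace E] {p : ℝ} (hp : 0 ≤ p) {f : E → ℝ} (hf : Measurable f)
    (hf_growth : BddAbove (range fun x => |f x| / (1 + ‖x‖ ^ p))) {u : T → E}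
    (hu : MemLp u (ENNReal.ofReal p) μ) : Integrable (fun t => f (u t)) μ := by
  obtain ⟨C, hC⟩ := hf_growth
  have hbound : ∀ x, |f x| ≤ C * (1 + ‖x‖ ^ p) := fun x =>
    (div_le_iff₀ (by positivity)).1 (hC (mem_range_self x))
  have hu_rpow : Integrable (fun t => ‖u t‖ ^ p) μ := by
    simpa only [ENNReal.toReal_ofReal hp] using hu.integrable_norm_rpow'
  exact (((integrable_const 1).add hu_rpow).const_mul C).mono'
    (hf.comp_aemeasurable hu.1.aemeasurable).aestronglyMeasurable
    (ae_of_all μ fun t => hbound (u t))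

open Classical in
theorem IsDecomposable.exists_ae_eq_piecewise [NormedSpace ℝ E] {p : ENNReal} {X : Set (Lp E p μ)}
    (hX : IsDecomposable X) {u v : Lp E p μ} (hu : u ∈ X) (hv : v ∈ X) {A : Set T}
    (hA : MeasurableSet A) : ∃ w ∈ X, w =ᵐ[μ] A.piecewise u v := by
  obtain ⟨w, hw, hwuv⟩ := hX u hu v hv A hA
  refine ⟨w, hw, hwuv.trans (ae_of_all μ fun t => ?_)⟩
  by_cases ht : t ∈ A <;> simp [ht]

open Classical in
theorem integral_comp_piecewise {α F : Type*} [NormedAddCommGroup F] [NormedSpace ℝ F]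
    {φ : α → F} {u v : T → α} {A : Set T} (hA : MeasurableSet A)
    (hu : Integrable (fun t => φ (u t)) μ) (hv : Integrable (fun t => φ (v t)) μ) :
    ∫ t, φ (A.piecewise u v t) ∂μ = (∫ t, φ (v t) ∂μ) + ∫ t in A, (φ (u t) - φ (v t)) ∂μ := by
  simp only [A.apply_piecewise u v fun _ => φ]
  rw [integral_piecewise hA hu.integrableOn hv.integrableOn,
    integral_sub hu.integrableOn hv.integrableOn, ← integral_add_compl hA hv]
  abel

open Classical in
theorem integralFunctional_of_ae_eq_piecewise {p : ENNReal} {f g : E → ℝ} {u v w : Lp E p μ}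
    {A : Set T} (hA : MeasurableSet A) (hw : w =ᵐ[μ] A.piecewise v u)
    (hfu : Integrable (fun t => f (u t)) μ) (hgu : Integrable (fun t => g (u t)) μ)
    (hfv : Integrable (fun t => f (v t)) μ) (hgv : Integrable (fun t => g (v t)) μ) :
    integralFunctional f g w = integralFunctional f g u +
      ((∫ t in A, (f (v t) - f (u t) + 2 * (∫ s, g (u s) ∂μ) * (g (v t) - g (u t))) ∂μ) +
        (∫ t in A, (g (v t) - g (u t)) ∂μ) ^ 2) := by
  have hcomp : ∀ φ : E → ℝ, ∫ t, φ (w t) ∂μ = ∫ t, φ (A.piecewise v u t) ∂μ := fun φ =>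
    integral_congr_ae (hw.fun_comp φ)
  have hsplit : ∀ a : ℝ, ∫ t in A, (f (v t) - f (u t) + a * (g (v t) - g (u t))) ∂μ =
      (∫ t in A, (f (v t) - f (u t)) ∂μ) + a * ∫ t in A, (g (v t) - g (u t)) ∂μ := fun a => by
    rw [← integral_const_mul]
    exact integral_add (hfv.sub hfu).integrableOn ((hgv.sub hgu).const_mul a).integrableOn
  rw [integralFunctional, integralFunctional, hcomp, hcomp, integral_comp_piecewise hA hfv hfu,
    integral_comp_piecewise hA hgv hgu, hsplit]
  ring

theorem ae_le_of_isMinOn_integralFunctional [NormedSpace ℝ E] (hμ : IsNonatomicMeasure μ)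
    {p : ENNReal} {f g : E → ℝ} {X : Set (Lp E p μ)} (hX : IsDecomposable X) {u v : Lp E p μ}
    (hu : u ∈ X) (hv : v ∈ X)
    (hfu : Integrable (fun t => f (u t)) μ) (hgu : Integrable (fun t => g (u t)) μ)
    (hfv : Integrable (fun t => f (v t)) μ) (hgv : Integrable (fun t => g (v t)) μ)
    (hmin : IsMinOn (integralFunctional f g) X u) :
    ∀ᵐ t ∂μ, f (u t) + 2 * (∫ s, g (u s) ∂μ) * g (u t) ≤
      f (v t) + 2 * (∫ s, g (u s) ∂μ) * g (v t) := by
  have hnonneg : ∀ᵐ t ∂μ, 0 ≤ f (v t) - f (u t) +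
      2 * (∫ s, g (u s) ∂μ) * (g (v t) - g (u t)) := by
    refine hμ.ae_nonneg_of_forall_setIntegral_add_sq_nonneg
      ((hfv.sub hfu).add ((hgv.sub hgu).const_mul _)) (hgv.sub hgu) fun A hA => ?_
    obtain ⟨w, hwX, hw⟩ := hX.exists_ae_eq_piecewise hv hu hA
    have hle := isMinOn_iff.1 hmin w hwX
    rw [integralFunctional_of_ae_eq_piecewise hA hw hfu hgu hfv hgv] at hle
    exact nonneg_of_le_add_right hle
  filter_upwards [hnonneg] with t ht
  linarith

theorem ae_isMinOn_of_isMinOn_integralFunctional [IsFiniteMeasure μ] [NormedSpace ℝ E]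
    (hμ : IsNonatomicMeasure μ) {p : ENNReal} {f g : E → ℝ} {X : Set (Lp E p μ)}
    (hX : IsDecomposable X) (hconst : ∀ x, Lp.const p μ x ∈ X) {u : Lp E p μ} (hu : u ∈ X)
    (hfu : Integrable (fun t => f (u t)) μ) (hgu : Integrable (fun t => g (u t)) μ)
    (hmin : IsMinOn (integralFunctional f g) X u) :
    ∀ᵐ t ∂μ, IsMinOn (fun x => f x + 2 * (∫ s, g (u s) ∂μ) * g x) univ (u t) := by
  refine eventually_isMinOn_of_forall_eventually_le fun x => ?_
  have hx : Lp.const p μ x =ᵐ[μ] fun _ => x := Lp.coeFn_const p μ x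
  have hint : ∀ φ : E → ℝ, Integrable (fun t => φ (Lp.const p μ x t)) μ := fun φ =>
    (integrable_const (φ x)).congr (hx.fun_comp φ).symm
  filter_upwards [hx, ae_le_of_isMinOn_integralFunctional hμ hX hu (hconst x) hfu hgu
    (hint f) (hint g) hmin] with t ht hle
  rwa [ht] at hle

theorem exists_isMinOn_eq_zero_of_integral_eq_zero [IsFiniteMeasure μ] [NeZero μ] {α : Type*}
    {f g : α → ℝ} (hf : {x | IsMinOn f univ x}.Subsingleton) {u : T → α}
    (hu : ∀ᵐ t ∂μ, IsMinOn f univ (u t)) (hgu : ∫ t, g (u t) ∂μ = 0) :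
    ∃ x, g x = 0 ∧ IsMinOn f univ x := by
  obtain ⟨t₀, ht₀⟩ := hu.exists
  have hconst : ∫ t, g (u t) ∂μ = μ.real univ * g (u t₀) := by
    rw [integral_congr_ae (hu.mono fun t ht => congrArg g (hf ht ht₀)), integral_const, smul_eq_mul]
  rw [hgu] at hconst
  exact ⟨u t₀, (mul_eq_zero.1 hconst.symm).resolve_left measureReal_univ_ne_zero, ht₀⟩

end IntegralFunctional

theorem theorem1p5_general {T E : Type*} [MeasurableSpace T] (μ : Measure T) [IsFiniteMeasure μ]
    (hμ_pos : 0 < μ Set.univ) (hμ : IsNonatomicMeasure μ)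
    [NormedAddCommGroup E] [NormedSpace ℝ E] [MeasurableSpace E] [BorelSpace E]
    (p : ℝ) (hp : 0 < p) (f g : E → ℝ) (hf : Measurable f) (hg : Measurable g)
    (hf_above : BddAbove (Set.range f))
    (hg_below : ¬ BddBelow (Set.range g)) (hg_above : ¬ BddAbove (Set.range g))
    (hf_growth : BddAbove (Set.range fun x : E => |f x| / (1 + ‖x‖ ^ p)))
    (hg_growth : BddAbove (Set.range fun x : E => |g x| / (1 + ‖x‖ ^ p)))
    (hf_min : {x : E | IsMinOn f Set.univ x}.Subsingleton)
    (hfg : ∀ x : E, g x = 0 → ¬ IsMinOn f Set.univ x) :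
    (∀ u : Lp E (ENNReal.ofReal p) μ,
      Integrable (fun t => f (u t)) μ ∧ Integrable (fun t => g (u t)) μ) ∧
    ∀ X : Set (Lp E (ENNReal.ofReal p) μ), IsDecomposable X →
      (∀ c : E, Lp.const (ENNReal.ofReal p) μ c ∈ X) →
      ¬ ∃ u ∈ X, IsMinOn (integralFunctional f g) X u := by
  have hint : ∀ u : Lp E (ENNReal.ofReal p) μ,
      Integrable (fun t => f (u t)) μ ∧ Integrable (fun t => g (u t)) μ := fun u =>
    ⟨integrable_comp_of_bddAbove_div_one_add_rpow hp.le hf hf_growth (Lp.memLp u),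
      integrable_comp_of_bddAbove_div_one_add_rpow hp.le hg hg_growth (Lp.memLp u)⟩
  refine ⟨hint, ?_⟩
  rintro X hX hconst ⟨u, hu, hmin⟩
  have : NeZero μ := ⟨Measure.measure_univ_pos.1 hμ_pos⟩
  have hae :=
    ae_isMinOn_of_isMinOn_integralFunctional hμ hX hconst hu (hint u).1 (hint u).2 hmin
  obtain ⟨t₀, ht₀⟩ := hae.exists
  have hc : 2 * ∫ t, g (u t) ∂μ = 0 := eq_zero_of_bddBelow_range_add_mul hf_above hg_below hg_above
    ⟨_, Set.forall_mem_range.2 fun x => isMinOn_iff.1 ht₀ x (Set.mem_univ x)⟩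
  simp only [hc, zero_mul, add_zero] at hae
  obtain ⟨x, hgx, hfx⟩ := exists_isMinOn_eq_zero_of_integral_eq_zero hf_min hae
    ((mul_eq_zero.1 hc).resolve_left two_ne_zero)
  exact hfg x hgx hfx

theorem theorem1p5 {T E : Type*} [MeasurableSpace T] (μ : Measure T) [IsFiniteMeasure μ]
    (hμ_pos : 0 < μ Set.univ) (hμ : IsNonatomicMeasure μ)
    [NormedAddCommGroup E] [NormedSpace ℝ E] [CompleteSpace E]
    (p : ℝ) (hp : 1 ≤ p) (f g : E → ℝ)
    (hf : LowerSemicontinuous f) (hg : Continuous g)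
    (hf_above : BddAbove (Set.range f))
    (hg_below : ¬ BddBelow (Set.range g)) (hg_above : ¬ BddAbove (Set.range g))
    (hf_growth : BddAbove (Set.range fun x : E => |f x| / (1 + ‖x‖ ^ p)))
    (hg_growth : BddAbove (Set.range fun x : E => |g x| / (1 + ‖x‖ ^ p)))
    (hf_min : {x : E | IsMinOn f Set.univ x}.Subsingleton)
    (hfg : ∀ x : E, g x = 0 → ¬ IsMinOn f Set.univ x) :
    -- the functional is well defined: both integrands are integrable
    (∀ u : Lp E (ENNReal.ofReal p) μ,
      Integrable (fun t => f (u t)) μ ∧ Integrable (fun t => g (u t)) μ) ∧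
    ∀ X : Set (Lp E (ENNReal.ofReal p) μ), IsDecomposable X →
      (∀ c : E, Lp.const (ENNReal.ofReal p) μ c ∈ X) →
      ¬ ∃ u ∈ X, IsMinOn (integralFunctional f g) X u := by
  borelize E
  exact theorem1p5_general μ hμ_pos hμ p (one_pos.trans_le hp) f g hf.measurable hg.measurable
    hf_above hg_below hg_above hf_growth hg_growth hf_min hfg
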